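/- Let $n\ge 1$, $a<b$, and let $\gamma=(\gamma_1,\dots,\gamma_{n+1}):[a,b]\to\mathbb{R}^{n+1}$ be continuous on $[a,b]$ and of class $C^{n+1}$ on $(a,b)$, such that all leading principal minors of the $(n+1)\times(n+1)$ matrix $(\gamma'(t),\dots,\gamma^{(n+1)}(t))$ are positive for all $t\in(a,b)$. For $v\in\mathbb{R}^{n+1}$ write $\bar v=(v_1,\dots,v_n)$ and $v^z=v_{n+1}$, and let $\bar\gamma=(\gamma_1,\dots,\gamma_n)$. Put $$\Delta_c^k=\{r\in\mathbb{R}^k: r_j\ge 0,\ \textstyle\sum_j r_j\le 1\},\qquad \Delta_*^k=\{y\in\mathbb{R}^k: a\le y_1\le\dots\le y_k\le b\}.$$ Define maps $U_n,L_n$ into $\mathbb{R}^{n+1}$ as follows. If $n=2\ell-1$, $$U_n(\beta_1,\dots,\beta_\ell,x_2,\dots,x_\ell)=\Big(1-\sum_{j=1}^{\ell}\beta_j\Big)\gamma(a)+\sum_{j=2}^{\ell}\beta_j\gamma(x_j)+\beta_1\gamma(b)\quad\text{on }\Delta_c^{\ell}\times\Delta_*^{\ell-1},$$ $$L_n(\lambda_2,\dots,\lambda_\ell,y_1,\dots,y_\ell)=\Big(1-\sum_{j=2}^{\ell}\lambda_j\Big)\gamma(y_1)+\sum_{j=2}^{\ell}\lambda_j\gamma(y_j)\quad\text{on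 }\Delta_c^{\ell-1}\times\Delta_*^{\ell};$$ if $n=2\ell$, $$U_n(\beta_1,\dots,\beta_\ell,x_1,\dots,x_\ell)=\sum_{j=1}^{\ell}\beta_j\gamma(x_j)+\Big(1-\sum_{j=1}^{\ell}\beta_j\Big)\gamma(b)\quad\text{on }\Delta_c^{\ell}\times\Delta_*^{\ell},$$ $$L_n(\lambda_1,\dots,\lambda_\ell,y_1,\dots,y_\ell)=\Big(1-\sum_{j=1}^{\ell}\lambda_j\Big)\gamma(a)+\sum_{j=1}^{\ell}\lambda_j\gamma(y_j)\quad\text{on }\Delta_c^{\ell}\times\Delta_*^{\ell}.$$ Then every $x\in\mathrm{conv}(\bar\gamma([a,b]))$ is of the form $\overline{U_n(p)}$ and of the form $\overline{L_n(q)}$ for some parameters $p,q$ in the respective domains; functions $B^{\sup}$ and $B^{\inf}$ on $\mathrm{conv}(\bar\gamma([a,b]))$ are well defined by $B^{\sup}(\overline{U_n(p)})=U_n(p)^z$ and $B^{\inf}(\overline{L_n(q)})=L_n(q)^z$ for all $p,q$ in the domains; and for all $x\in\mathrm{conv}(\bar\gamma([a,b]))$ $$\sup_{a\le Y\le b}\{\mathbb{E}\gamma_{n+1}(Y):\mathbb{E}\bar\gamma(Y)=x\}=B^{\sup}(x),\qquad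 \inf_{a\le Y\le b}\{\mathbb{E}\gamma_{n+1}(Y):\mathbb{E}\bar\gamma(Y)=x\}=B^{\inf}(x),$$ where $Y$ ranges over all $[a,b]$-valued random variables for which every $\gamma_j(Y)$, $1\le j\le n+1$, is measurable. Moreover the supremum is attained by every random variable $\zeta$ and the infimum by every random variable $\xi$ with the following laws (such random variables exist), where $\delta_t$ is the unit mass at $t$, and $p$, $q$ are any parameters in the domains with $x=\overline{U_n(p)}=\overline{L_n(q)}$. Case 1, $n=2\ell-1$, $p=(\beta_1,\dots,\beta_\ell,x_2,\dots,x_\ell)$, $q=(\lambda_2,\dots,\lambda_\ell,y_1,\dots,y_\ell)$: $\zeta$ has law $(1-\sum_{j=1}^{\ell}\beta_j)\delta_a+\sum_{j=2}^{\ell}\beta_j\delta_{x_j}+\beta_1\delta_b$, and $\xi$ has law $(1-\sum_{j=2}^{\ell}\lambda_j)\delta_{y_1}+\sum_{j=2}^{\ell}\lambda_j\delta_{y_j}$. Case 2, $n=2\ell$, $p=(\beta_1,\dots,\beta_\ell,x_1,\dots,x_\ell)$, $q=(\lambda_1,\dots,\lambda_\ell,y_1,\dots,y_\ell)$: $\zeta$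 has law $\sum_{j=1}^{\ell}\beta_j\delta_{x_j}+(1-\sum_{j=1}^{\ell}\beta_j)\delta_b$, and $\xi$ has law $(1-\sum_{j=1}^{\ell}\lambda_j)\delta_a+\sum_{j=1}^{\ell}\lambda_j\delta_{y_j}$. -/

import Mathlib

open MeasureTheory

universe u

/-- The projection `v̄ = (v₁, …, vₙ)` of `v ∈ ℝⁿ⁺¹` onto the first `n` coordinates. -/
def bar {n : ℕ} (v : Fin (n + 1) → ℝ) : Fin n → ℝ := fun i => v i.castSucc

/-- The last coordinate `v^z = vₙ₊₁` of `v ∈ ℝⁿ⁺¹`. -/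
def lastCoord {n : ℕ} (v : Fin (n + 1) → ℝ) : ℝ := v (Fin.last n)

/-- The matrix `(γ'(t), γ''(t), …, γ⁽ⁿ⁺¹⁾(t))` whose columns are the derivatives of `γ`:
its entry in row `i` and column `j` (counted from `0`) is the derivative of order `j + 1` of the
`i`-th coordinate of `γ`. -/
noncomputable def torsionMatrix {n : ℕ} (γ : ℝ → Fin (n + 1) → ℝ) (t : ℝ) :
    Matrix (Fin (n + 1)) (Fin (n + 1)) ℝ :=
  Matrix.of fun i j => iteratedDeriv ((j : ℕ) + 1) (fun s => γ s i) t

/-- `γ ∈ C([a,b]) ∩ Cⁿ⁺¹((a,b))`, and all leading principal minors of `(γ', …, γ⁽ⁿ⁺¹⁾)` are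
positive on `(a,b)`. (The empty minor `k = 0` equals `1`.) -/
structure HasTotallyPositiveTorsion {n : ℕ} (γ : ℝ → Fin (n + 1) → ℝ) (a b : ℝ) : Prop where
  continuousOn : ContinuousOn γ (Set.Icc a b)
  contDiffOn : ContDiffOn ℝ ((n + 1 : ℕ) : WithTop ℕ∞) γ (Set.Ioo a b)
  minor_pos : ∀ t ∈ Set.Ioo a b, ∀ (k : ℕ) (hk : k ≤ n + 1),
    0 < ((torsionMatrix γ t).submatrix (Fin.castLE hk) (Fin.castLE hk)).det

/-- `Δ_c^k = {r ∈ ℝᵏ : r_j ≥ 0, r₁ + ⋯ + r_k ≤ 1}`. -/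
def simplexC (k : ℕ) : Set (Fin k → ℝ) := {r | (∀ j, 0 ≤ r j) ∧ ∑ j, r j ≤ 1}

/-- `Δ_*^k = {y ∈ ℝᵏ : a ≤ y₁ ≤ ⋯ ≤ y_k ≤ b}`. -/
def simplexStar (a b : ℝ) (k : ℕ) : Set (Fin k → ℝ) :=
  {y | (∀ j, y j ∈ Set.Icc a b) ∧ Monotone y}

section Maps

variable {n ℓ : ℕ}

/-- The map `Uₙ` for `n = 2ℓ`: `∑ λ_j γ(x_j) + (1 - ∑ λ_j) γ(b)`. -/
noncomputable def upperEven (γ : ℝ → Fin (n + 1) → ℝ) (b : ℝ)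
    (lam x : Fin ℓ → ℝ) : Fin (n + 1) → ℝ :=
  ∑ j, lam j • γ (x j) + (1 - ∑ j, lam j) • γ b

/-- The map `Lₙ` for `n = 2ℓ`: `(1 - ∑ λ_j) γ(a) + ∑ λ_j γ(x_j)`. -/
noncomputable def lowerEven (γ : ℝ → Fin (n + 1) → ℝ) (a : ℝ)
    (lam x : Fin ℓ → ℝ) : Fin (n + 1) → ℝ :=
  (1 - ∑ j, lam j) • γ a + ∑ j, lam j • γ (x j)

/-- The map `Uₙ` for `n = 2(ℓ+1) - 1 = 2ℓ + 1`, with weights `β₁, …, β_{ℓ+1}` (stored as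
`β 0, …, β ℓ`) and nodes `x₂, …, x_{ℓ+1}` (stored as `x 0, …, x (ℓ-1)`):
`(1 - ∑_{j ≥ 1} β_j) γ(a) + ∑_{j ≥ 2} β_j γ(x_j) + β₁ γ(b)`. -/
noncomputable def upperOdd (γ : ℝ → Fin (n + 1) → ℝ) (a b : ℝ)
    (β : Fin (ℓ + 1) → ℝ) (x : Fin ℓ → ℝ) : Fin (n + 1) → ℝ :=
  (1 - ∑ j, β j) • γ a + ∑ j : Fin ℓ, β j.succ • γ (x j) + β 0 • γ b

/-- The map `Lₙ` for `n = 2(ℓ+1) - 1 = 2ℓ + 1`, with weights `β₂, …, β_{ℓ+1}` (stored as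
`β 0, …, β (ℓ-1)`) and nodes `x₁, …, x_{ℓ+1}` (stored as `x 0, …, x ℓ`):
`(1 - ∑_{j ≥ 2} β_j) γ(x₁) + ∑_{j ≥ 2} β_j γ(x_j)`. -/
noncomputable def lowerOdd (γ : ℝ → Fin (n + 1) → ℝ)
    (β : Fin ℓ → ℝ) (x : Fin (ℓ + 1) → ℝ) : Fin (n + 1) → ℝ :=
  (1 - ∑ j, β j) • γ (x 0) + ∑ j : Fin ℓ, β j • γ (x j.succ)

/-- The law of the discrete random variable `ζ` for `n = 2ℓ`: mass `λ_j` at `x_j` and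
`1 - ∑ λ_j` at `b` (masses of coinciding nodes add up). -/
noncomputable def upperEvenLaw (b : ℝ) (lam x : Fin ℓ → ℝ) : Measure ℝ :=
  ∑ j, ENNReal.ofReal (lam j) • Measure.dirac (x j)
    + ENNReal.ofReal (1 - ∑ j, lam j) • Measure.dirac b

/-- The law of the discrete random variable `ξ` for `n = 2ℓ`: mass `1 - ∑ λ_j` at `a` and
`λ_j` at `x_j`. -/
noncomputable def lowerEvenLaw (a : ℝ) (lam x : Fin ℓ → ℝ) : Measure ℝ :=
  ENNReal.ofReal (1 - ∑ j, lam j) • Measure.dirac a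
    + ∑ j, ENNReal.ofReal (lam j) • Measure.dirac (x j)

/-- The law of the discrete random variable `ζ` for `n = 2ℓ + 1`, indexed as in `upperOdd`. -/
noncomputable def upperOddLaw (a b : ℝ) (β : Fin (ℓ + 1) → ℝ) (x : Fin ℓ → ℝ) : Measure ℝ :=
  ENNReal.ofReal (1 - ∑ j, β j) • Measure.dirac a
    + ∑ j : Fin ℓ, ENNReal.ofReal (β j.succ) • Measure.dirac (x j)
    + ENNReal.ofReal (β 0) • Measure.dirac b

/-- The law of the discrete random variable `ξ` for `n = 2ℓ + 1`, indexed as in `lowerOdd`. -/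
noncomputable def lowerOddLaw (β : Fin ℓ → ℝ) (x : Fin (ℓ + 1) → ℝ) : Measure ℝ :=
  ENNReal.ofReal (1 - ∑ j, β j) • Measure.dirac (x 0)
    + ∑ j : Fin ℓ, ENNReal.ofReal (β j) • Measure.dirac (x j.succ)

/-- The function `B` with `B(W̄(p)) = W^z(p)` for all parameters `p ∈ D`, extended by `0` off
`W̄(D)`. If `B` were not well defined on `W̄(D)`, a parameter `p` would be chosen for each point;
that the identity holds for every `p ∈ D` is a claim to be proved. -/
noncomputable def graphFunction {Q : Type*} (D : Set Q) (W : Q → Fin (n + 1) → ℝ) :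
    (Fin n → ℝ) → ℝ :=
  Function.extend (fun p : D => bar (W p)) (fun p : D => lastCoord (W p)) 0

end Maps

open Classical in
/-- `B^sup`, given by `B^sup(Ūₙ) = Uₙ^z`. For odd `n`, `n / 2 = (n - 1) / 2`. -/
noncomputable def Bsup {n : ℕ} (γ : ℝ → Fin (n + 1) → ℝ) (a b : ℝ) : (Fin n → ℝ) → ℝ :=
  if Even n then
    graphFunction (simplexC (n / 2) ×ˢ simplexStar a b (n / 2))
      (fun p => upperEven γ b p.1 p.2)
  else
    graphFunction (simplexC (n / 2 + 1) ×ˢ simplexStar a b (n / 2))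
      (fun p => upperOdd γ a b p.1 p.2)

open Classical in
/-- `B^inf`, given by `B^inf(L̄ₙ) = Lₙ^z`. For odd `n`, `n / 2 = (n - 1) / 2`. -/
noncomputable def Binf {n : ℕ} (γ : ℝ → Fin (n + 1) → ℝ) (a b : ℝ) : (Fin n → ℝ) → ℝ :=
  if Even n then
    graphFunction (simplexC (n / 2) ×ˢ simplexStar a b (n / 2))
      (fun p => lowerEven γ a p.1 p.2)
  else
    graphFunction (simplexC (n / 2) ×ˢ simplexStar a b (n / 2 + 1))
      (fun p => lowerOdd γ p.1 p.2)

/-- `Y` is a competitor in the moment problem at `x`: an `[a,b]`-valued function on the probability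
space `(Ω, P)` such that every `γ_j(Y)` is measurable and `E γ_j(Y) = x_j` for `j = 1, …, n`. -/
structure IsCompetitor {n : ℕ} (γ : ℝ → Fin (n + 1) → ℝ) {a b : ℝ} (x : Fin n → ℝ)
    {Ω : Type*} [MeasurableSpace Ω] (P : Measure Ω) (Y : Ω → Set.Icc a b) : Prop where
  measurable : ∀ j, Measurable fun ω => γ (Y ω) j
  moments : ∀ j : Fin n, ∫ ω, bar (γ (Y ω)) j ∂P = x j

/-- The set `{E γₙ₊₁(Y) : a ≤ Y ≤ b, E γ̄(Y) = x}`, over all random variables `Y` on all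
probability spaces. -/
def momentValues {n : ℕ} (γ : ℝ → Fin (n + 1) → ℝ) (a b : ℝ) (x : Fin n → ℝ) : Set ℝ :=
  {v | ∃ (Ω : Type u) (_ : MeasurableSpace Ω) (P : Measure Ω) (_ : IsProbabilityMeasure P)
    (Y : Ω → Set.Icc a b), IsCompetitor γ x P Y ∧ ∫ ω, lastCoord (γ (Y ω)) ∂P = v}

/-- There are `[a,b]`-valued random variables with law `μ`, and each of them is a competitor in
the moment problem at `x` with `E γₙ₊₁ = v`. -/
def AttainedByLaw {n : ℕ} (γ : ℝ → Fin (n + 1) → ℝ) (a b : ℝ) (x : Fin n → ℝ)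
    (μ : Measure ℝ) (v : ℝ) : Prop :=
  (∃ (Ω : Type u) (_ : MeasurableSpace Ω) (P : Measure Ω) (_ : IsProbabilityMeasure P)
    (ζ : Ω → Set.Icc a b), Measurable ζ ∧ P.map (fun ω => (ζ ω : ℝ)) = μ) ∧
  ∀ (Ω : Type u) [MeasurableSpace Ω] (P : Measure Ω) [IsProbabilityMeasure P]
    (ζ : Ω → Set.Icc a b), Measurable ζ → P.map (fun ω => (ζ ω : ℝ)) = μ →
      IsCompetitor γ x P ζ ∧ ∫ ω, lastCoord (γ (ζ ω)) ∂P = v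

/-! The vector E γ(Y) lies in the convex hull K of the curve, which is compact, and every point of K
is the barycentre of a finitely supported law. Over x the problem thus asks for the highest and
lowest point of K, both attained; it remains to find the laws that represent them.

The torsion condition makes 1, γ₁, …, γₙ₊₁ a Chebyshev system on [a,b]: determinants with increasing
nodes are positive (`HasTotallyPositiveTorsion.det_pos`). This has two consequences. A signed
measure on at most n+1 points that annihilates 1, γ₁, …, γₙ vanishes (`eq_zero_of_moments`). Any n+2
points carry an alternating measure that annihilates these functions and is positive on γₙ₊₁
(`exists_alternating`).

If a law has atoms at all negative nodes of the alternating measure, adding a small multiple raises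
the last coordinate. So a law representing a highest point has few atoms, endpoints being free or
not according to parity (`card_support_sdiff_le`); lowest points are treated with the opposite sign.
Conversely, two laws with so few atoms differ on at most n+1 points, so they coincide once their
first n moments agree (`eq_of_bar_eq`). Hence every law of this shape is extremal, which gives
well-definedness, optimality and attainment together. -/

/-! ### Positivity of generalised Vandermonde determinants -/

/-- The mean value theorem applied in each column of a determinant of increments. -/
lemma exists_det_sub_eq_prod_mul_det_deriv {k : ℕ} (f f' : Fin k → ℝ → ℝ) (α β : Fin k → ℝ)
    (hαβ : ∀ j, α j < β j)
    (hf : ∀ i j, ContinuousOn (f i) (Set.Icc (α j) (β j)))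
    (hf' : ∀ i j, ∀ x ∈ Set.Ioo (α j) (β j), HasDerivAt (f i) (f' i x) x) :
    ∃ s : Fin k → ℝ, (∀ j, s j ∈ Set.Ioo (α j) (β j)) ∧
      (Matrix.of fun i j => f i (β j) - f i (α j)).det =
        (∏ j, (β j - α j)) * (Matrix.of fun i j => f' i (s j)).det := by
  -- Columns are replaced one at a time, S being those already done. The determinant is linear in
  -- each column, so the scalar mean value theorem gives one point serving all rows of that column.
  suffices H : ∀ S : Finset (Fin k), ∃ s : Fin k → ℝ, (∀ j ∈ S, s j ∈ Set.Ioo (α j) (β j)) ∧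
      (Matrix.of fun i j => f i (β j) - f i (α j)).det = (∏ j ∈ S, (β j - α j)) *
        (Matrix.of fun i j => if j ∈ S then f' i (s j) else f i (β j) - f i (α j)).det by
    simpa using H Finset.univ
  intro S
  induction S using Finset.induction_on with
  | empty => exact ⟨α, by simp⟩
  | insert j₀ S hj₀ ih =>
    obtain ⟨s, hs, hdet⟩ := ih
    set A : Matrix (Fin k) (Fin k) ℝ :=
      Matrix.of fun i j => if j ∈ S then f' i (s j) else f i (β j) - f i (α j) with hA
    have hlin : ∀ v : Fin k → ℝ, (A.updateCol j₀ v).det = ∑ i, A.adjugate j₀ i * v i := by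
      intro v
      rw [← Matrix.cramer_apply, Matrix.cramer_eq_adjugate_mulVec]
      rfl
    obtain ⟨c, hc, hslope⟩ := exists_hasDerivAt_eq_slope
      (fun x => ∑ i, A.adjugate j₀ i * f i x) (fun x => ∑ i, A.adjugate j₀ i * f' i x) (hαβ j₀)
      (continuousOn_finsetSum _ fun i _ => continuousOn_const.mul (hf i j₀))
      (fun x hx => HasDerivAt.fun_sum fun i _ => (hf' i j₀ x hx).const_mul _)
    refine ⟨Function.update s j₀ c, ?_, ?_⟩
    · intro j hj
      rcases eq_or_ne j j₀ with rfl | hne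
      · simpa using hc
      · simpa [hne] using hs j (by simpa [hne] using hj)
    · have h1 : A = A.updateCol j₀ (fun i => f i (β j₀) - f i (α j₀)) := by
        ext i j
        rcases eq_or_ne j j₀ with rfl | hne
        · simp [hA, hj₀]
        · simp [hne]
      have h2 : (Matrix.of fun i j => if j ∈ insert j₀ S then f' i (Function.update s j₀ c j)
          else f i (β j) - f i (α j)) = A.updateCol j₀ (fun i => f' i c) := by
        ext i j
        rcases eq_or_ne j j₀ with rfl | hne
        · simp
        · simp [hne, hA]
      have h3 : A.det = (β j₀ - α j₀) * (A.updateCol j₀ (fun i => f' i c)).det := by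
        rw [h1, hlin, ← h1, hlin, hslope, mul_div_cancel₀ _ (sub_pos.2 (hαβ j₀)).ne',
          ← Finset.sum_sub_distrib]
        exact Finset.sum_congr rfl fun i _ => by ring
      rw [h2, Finset.prod_insert hj₀, hdet, h3]
      ring

/-- Subtracting from each column its predecessor turns the row of ones into (1, 0, …, 0); then
expand along it. -/
lemma det_eq_det_sub_of_row_zero_eq_one {k : ℕ} (A : Matrix (Fin (k + 1)) (Fin (k + 1)) ℝ)
    (hA : ∀ j, A 0 j = 1) :
    A.det = (Matrix.of fun i j : Fin k => A i.succ j.succ - A i.succ j.castSucc).det := by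
  let B : Matrix (Fin (k + 1)) (Fin (k + 1)) ℝ :=
    Matrix.of fun i => Fin.cases (A i 0) fun j => A i j.succ - A i j.castSucc
  rw [Matrix.det_eq_of_forall_col_eq_smul_add_pred (B := B) (fun _ => 1) (fun i => by simp [B])
    (fun i j => by simp [B]), Matrix.det_succ_row_zero, Fin.sum_univ_succ]
  simp only [B, Matrix.of_apply, Fin.cases_zero, Fin.cases_succ, hA]
  simp only [sub_self, mul_zero, zero_mul, Finset.sum_const_zero, add_zero, Fin.val_zero, pow_zero,
    one_mul]
  congr 1

/-- If the determinants `det (F'ᵢ₊₁(sⱼ))` of order `k` are positive, then so are the determinants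
of order `k + 1` of the system `1 = F₀, F₁, …, F_k`. -/
lemma det_pos_of_det_deriv_pos {k : ℕ} {F F' : ℕ → ℝ → ℝ} {a b : ℝ} (hF0 : ∀ x, F 0 x = 1)
    (hF : ∀ i < k, ContinuousOn (F (i + 1)) (Set.Icc a b))
    (hF' : ∀ i < k, ∀ x ∈ Set.Ioo a b, HasDerivAt (F (i + 1)) (F' i x) x)
    (hpos : ∀ s : Fin k → ℝ, StrictMono s → (∀ j, s j ∈ Set.Ioo a b) →
      0 < (Matrix.of fun i j : Fin k => F' i (s j)).det)
    (t : Fin (k + 1) → ℝ) (ht : StrictMono t) (htab : ∀ j, t j ∈ Set.Icc a b) :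
    0 < (Matrix.of fun i j : Fin (k + 1) => F i (t j)).det := by
  rw [det_eq_det_sub_of_row_zero_eq_one _ (fun j => by simp [hF0])]
  have hlt : ∀ j : Fin k, t j.castSucc < t j.succ := fun j => ht Fin.castSucc_lt_succ
  obtain ⟨s, hs, hdet⟩ := exists_det_sub_eq_prod_mul_det_deriv (fun i : Fin k => F (i + 1))
    (fun i => F' i) (fun j => t j.castSucc) (fun j => t j.succ) hlt
    (fun i j => (hF i i.2).mono (Set.Icc_subset_Icc (htab _).1 (htab _).2))
    (fun i j x hx => hF' i i.2 x (Set.Ioo_subset_Ioo (htab _).1 (htab _).2 hx))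
  simp only [Matrix.of_apply, Fin.val_succ] at hdet ⊢
  rw [hdet]
  refine mul_pos (Finset.prod_pos fun j _ => sub_pos.2 (hlt j)) (hpos s ?_ fun j => ?_)
  · intro i j hij
    calc s i < t i.succ := (hs i).2
      _ ≤ t j.castSucc := ht.monotone (Fin.succ_le_castSucc_iff.2 hij)
      _ < s j := (hs j).1
  · exact Set.Ioo_subset_Ioo (htab _).1 (htab _).2 (hs j)

/-- Dividing the functions of a system by the first one, and differentiating, lowers the order of
the Wronskian by one. -/
lemma wronskian_div_deriv {m : ℕ} {u : ℕ → ℝ → ℝ} {x : ℝ}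
    (hu : ∀ i ≤ m, ContDiffAt ℝ m (u i) x) (hx : 0 < u 0 x) :
    (Matrix.of fun i j : Fin (m + 1) => iteratedDeriv j (u i) x).det =
      u 0 x ^ (m + 1) * (Matrix.of fun i j : Fin m =>
        iteratedDeriv j (deriv fun s => u (i + 1) s / u 0 s) x).det := by
  have hev : ∀ᶠ s in nhds x, u 0 s ≠ 0 :=
    ((hu 0 (Nat.zero_le _)).continuousAt.eventually (lt_mem_nhds hx)).mono fun s hs => ne_of_gt hs
  let q : ℕ → ℝ → ℝ := fun i s => u i s / u 0 s
  have hq : ∀ i ≤ m, ContDiffAt ℝ m (q i) x := fun i hi =>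
    (hu i hi).div (hu 0 (Nat.zero_le _)) hx.ne'
  -- The Leibniz rule for u i = q i * u 0, in matrix form. T is upper triangular with diagonal u 0
  -- x; where `j - l` truncates, the binomial coefficient is zero.
  let T : Matrix (Fin (m + 1)) (Fin (m + 1)) ℝ := Matrix.of fun l j =>
    ((j : ℕ).choose l : ℝ) * iteratedDeriv ((j : ℕ) - l) (u 0) x
  have hT : T.det = u 0 x ^ (m + 1) := by
    rw [Matrix.det_of_isUpperTriangular]
    · simp [T]
    · intro i j hij
      have : (j : ℕ) < i := hij
      simp [T, Nat.choose_eq_zero_of_lt this]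
  let Q : Matrix (Fin (m + 1)) (Fin (m + 1)) ℝ := Matrix.of fun i j => iteratedDeriv j (q i) x
  have hmul : (Matrix.of fun i j : Fin (m + 1) => iteratedDeriv j (u i) x) = Q * T := by
    ext i j
    have hi : (i : ℕ) ≤ m := Nat.lt_succ_iff.1 i.2
    have hj : (j : ℕ) ≤ m := Nat.lt_succ_iff.1 j.2
    have hjm : ((j : ℕ) : WithTop ℕ∞) ≤ (m : WithTop ℕ∞) := by exact_mod_cast hj
    have heq : u i =ᶠ[nhds x] q i * u 0 := by
      filter_upwards [hev] with s hs
      simp [q, hs]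
    rw [Matrix.of_apply, heq.iteratedDeriv_eq, iteratedDeriv_mul ((hq i hi).of_le hjm)
      ((hu 0 (Nat.zero_le _)).of_le hjm), Matrix.mul_apply]
    refine Eq.trans ?_ (Fin.sum_univ_eq_sum_range (fun l => iteratedDeriv l (q i) x *
      (((j : ℕ).choose l : ℝ) * iteratedDeriv ((j : ℕ) - l) (u 0) x)) (m + 1)).symm
    rw [← Finset.sum_subset (Finset.range_mono (Nat.succ_le_succ hj))]
    · exact Finset.sum_congr rfl fun l _ => by ring
    · intro l _ hl
      have : (j : ℕ) < l := by simpa using hl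
      simp [Nat.choose_eq_zero_of_lt this]
  have hq0 : q 0 =ᶠ[nhds x] fun _ => 1 := by
    filter_upwards [hev] with s hs
    simp [q, hs]
  have hQ : Q.det = (Matrix.of fun i j : Fin m =>
      iteratedDeriv j (deriv fun s => u (i + 1) s / u 0 s) x).det := by
    rw [Matrix.det_succ_row_zero, Fin.sum_univ_succ]
    have h0 : ∀ j : Fin m, Q 0 j.succ = 0 := by
      intro j
      simp only [Q, Matrix.of_apply, Fin.val_zero]
      rw [hq0.iteratedDeriv_eq]
      simp [iteratedDeriv_const]
    have h1 : Q 0 0 = 1 := by simp [Q, q, hx.ne']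
    simp only [h0, h1, mul_zero, zero_mul, Finset.sum_const_zero, add_zero, Fin.val_zero, pow_zero,
      one_mul]
    congr 1
    ext i j
    simp [Q, q, iteratedDeriv_succ']
  rw [hmul, Matrix.det_mul, hT, hQ, mul_comm]

/-- If all Wronskians of `u₀, …, u_m`, `m < k`, are positive on an interval, then so are all
determinants `det (uᵢ(tⱼ))` of order `k` with increasing nodes. -/
lemma det_pos_of_wronskian_pos {a b : ℝ} (k : ℕ) : ∀ (u : ℕ → ℝ → ℝ),
    (∀ i < k, ContDiffOn ℝ ((k - 1 : ℕ) : WithTop ℕ∞) (u i) (Set.Ioo a b)) →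
    (∀ x ∈ Set.Ioo a b, ∀ m ≤ k,
      0 < (Matrix.of fun i j : Fin m => iteratedDeriv j (u i) x).det) →
    ∀ t : Fin k → ℝ, StrictMono t → (∀ j, t j ∈ Set.Ioo a b) →
      0 < (Matrix.of fun i j : Fin k => u i (t j)).det := by
  induction k with
  | zero => intro u _ _ t _ _; simp
  | succ k ih =>
    intro u hu hW t ht htab
    have hu0 : ∀ x ∈ Set.Ioo a b, 0 < u 0 x := fun x hx => by
      simpa using hW x hx 1 (by omega)
    have hq : ∀ i ≤ k, ContDiffOn ℝ (k : WithTop ℕ∞) (fun s => u i s / u 0 s) (Set.Ioo a b) :=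
      fun i hi => (hu i (by omega)).div (hu 0 (by omega)) fun x hx => (hu0 x hx).ne'
    -- Factoring u 0 (t j) out of column j leaves quotients with first row 1. The `if` makes that
    -- row 1 also off (a,b), where u 0 may vanish.
    have hfac : (Matrix.of fun i j : Fin (k + 1) => u i (t j)).det =
        (∏ j, u 0 (t j)) * (Matrix.of fun i j : Fin (k + 1) =>
          (fun (i : ℕ) s => if i = 0 then 1 else u i s / u 0 s) i (t j)).det := by
      rw [← Matrix.det_mul_row]
      congr 1
      ext i j
      have := (hu0 _ (htab j)).ne'
      by_cases hi : (i : ℕ) = 0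
      · obtain rfl : i = 0 := Fin.ext hi
        simp
      · simp only [Matrix.of_apply, hi, if_false]
        field_simp
    rw [hfac]
    refine mul_pos (Finset.prod_pos fun j _ => hu0 _ (htab j)) ?_
    -- Nothing is known at a and b here, so the closed interval is shrunk to the span of the nodes.
    have hsub : Set.Icc (t 0) (t (Fin.last k)) ⊆ Set.Ioo a b := fun x hx =>
      ⟨(htab 0).1.trans_le hx.1, hx.2.trans_lt (htab _).2⟩
    refine det_pos_of_det_deriv_pos
      (F := fun i s => if i = 0 then 1 else u i s / u 0 s) (F' := fun i => deriv fun s => u (i + 1) s / u 0 s)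
      (a := t 0) (b := t (Fin.last k)) (fun _ => rfl) ?_ ?_ ?_ t ht
      (fun j => ⟨ht.monotone (Fin.zero_le _), ht.monotone (Fin.le_last _)⟩)
    · intro i hi
      simpa using (hq (i + 1) hi).continuousOn.mono hsub
    · intro i hi x hx
      have hk : (k : WithTop ℕ∞) ≠ 0 := by
        have : k ≠ 0 := by omega
        exact_mod_cast this
      simpa using (((hq (i + 1) hi).contDiffAt (isOpen_Ioo.mem_nhds
        (hsub (Set.Ioo_subset_Icc_self hx)))).differentiableAt hk).hasDerivAt
    · intro s hs hst
      refine ih (fun i => deriv fun s => u (i + 1) s / u 0 s) (fun i hi => ?_)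
        (fun x hx m hm => ?_) s hs
        fun j => hsub (Set.Ioo_subset_Icc_self (hst j))
      · refine (hq (i + 1) hi).deriv_of_isOpen isOpen_Ioo ?_
        have : k - 1 + 1 ≤ k := by omega
        exact_mod_cast this
      · have h := hW x hx (m + 1) (by omega)
        rw [wronskian_div_deriv (fun i hi => ?_) (hu0 x hx)] at h
        · exact (pos_iff_pos_of_mul_pos h).1 (pow_pos (hu0 x hx) _)
        · refine ((hu i (by omega)).contDiffAt (isOpen_Ioo.mem_nhds hx)).of_le ?_
          simpa using hm

/-! ### The Chebyshev system `1, γ₁, …, γₙ₊₁` -/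

/-- The functions `1, γ₁, …, γₙ₊₁`, followed by zeros. -/
noncomputable def chebyshevSystem {n : ℕ} (γ : ℝ → Fin (n + 1) → ℝ) : ℕ → ℝ → ℝ
  | 0, _ => 1
  | i + 1, t => if h : i < n + 1 then γ t ⟨i, h⟩ else 0

lemma chebyshevSystem_succ {n : ℕ} (γ : ℝ → Fin (n + 1) → ℝ) {i : ℕ} (h : i < n + 1) :
    chebyshevSystem γ (i + 1) = fun t => γ t ⟨i, h⟩ := by
  ext t
  simp [chebyshevSystem, h]

/-- At the endpoints γ is only continuous. The constant first function allows one use of the mean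
value theorem, which moves the nodes into (a,b); there the Wronskians of γ' are the leading
principal minors of the torsion matrix. -/
lemma HasTotallyPositiveTorsion.det_pos {n : ℕ} {γ : ℝ → Fin (n + 1) → ℝ} {a b : ℝ}
    (hγ : HasTotallyPositiveTorsion γ a b) {k : ℕ} (hk : k ≤ n + 1) {t : Fin (k + 1) → ℝ}
    (ht : StrictMono t) (htab : ∀ j, t j ∈ Set.Icc a b) :
    0 < (Matrix.of fun i j : Fin (k + 1) => chebyshevSystem γ i (t j)).det := by
  have hsmooth : ∀ i < k, ContDiffOn ℝ ((n + 1 : ℕ) : WithTop ℕ∞) (chebyshevSystem γ (i + 1))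
      (Set.Ioo a b) := by
    intro i hi
    rw [chebyshevSystem_succ γ (hi.trans_le hk)]
    exact contDiffOn_pi.1 hγ.contDiffOn _
  refine det_pos_of_det_deriv_pos (F' := fun i => deriv (chebyshevSystem γ (i + 1)))
    (fun _ => rfl) ?_ ?_ ?_ t ht htab
  · intro i hi
    rw [chebyshevSystem_succ γ (hi.trans_le hk)]
    exact continuousOn_pi.1 hγ.continuousOn _
  · intro i hi x hx
    refine (((hsmooth i hi).contDiffAt (isOpen_Ioo.mem_nhds hx)).differentiableAt ?_).hasDerivAt
    exact_mod_cast Nat.succ_ne_zero n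
  · intro s hs hst
    refine det_pos_of_wronskian_pos k (fun i => deriv (chebyshevSystem γ (i + 1)))
      (fun i hi => ?_) (fun x hx m hm => ?_) s hs hst
    · refine (hsmooth i hi).deriv_of_isOpen isOpen_Ioo ?_
      have : k - 1 + 1 ≤ n + 1 := by omega
      exact_mod_cast this
    · convert hγ.minor_pos x hx m (hm.trans hk) using 2
      ext i j
      simp only [Matrix.of_apply, Matrix.submatrix_apply, torsionMatrix, ← iteratedDeriv_succ']
      rw [chebyshevSystem_succ γ (i.2.trans_le (hm.trans hk))]
      rfl

lemma Set.Infinite.exists_finset_superset_card_eq {α : Type*} {t : Set α} (ht : t.Infinite)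
    {s : Finset α} (hst : ↑s ⊆ t) {k : ℕ} (hk : s.card ≤ k) :
    ∃ S : Finset α, s ⊆ S ∧ ↑S ⊆ t ∧ S.card = k := by
  obtain ⟨S, hsS, hS, hSk⟩ := Set.exists_superset_subset_encard_eq hst (k := k)
    (by simpa using hk) (by simp [ht.encard_eq])
  lift S to Finset α using Set.finite_of_encard_eq_coe hSk
  exact ⟨S, by simpa using hsS, hS, by simpa using hSk⟩

/-- A finitely supported measure on `n + 1` points of `[a,b]` is determined by its moments with
respect to `1, γ₁, …, γₙ`. -/
lemma HasTotallyPositiveTorsion.eq_zero_of_moments {n : ℕ} {γ : ℝ → Fin (n + 1) → ℝ} {a b : ℝ}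
    (hγ : HasTotallyPositiveTorsion γ a b) (hab : a < b) {w : ℝ →₀ ℝ}
    (hw : ∀ r ∈ w.support, r ∈ Set.Icc a b) (hcard : w.support.card ≤ n + 1)
    (hmom : ∀ i ≤ n, Finsupp.linearCombination ℝ (chebyshevSystem γ i) w = 0) : w = 0 := by
  -- Padding the support with points of mass zero to exactly n+1 nodes makes the moment system
  -- square.
  obtain ⟨S, hwS, hS, hSc⟩ :=
    (Set.Icc_infinite hab).exists_finset_superset_card_eq (s := w.support) hw hcard
  let t := S.orderEmbOfFin hSc
  have hdet := hγ.det_pos (k := n) (by omega) t.strictMono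
    (fun j => hS (Finset.orderEmbOfFin_mem S hSc j))
  have hker : (Matrix.of fun i j : Fin (n + 1) => chebyshevSystem γ i (t j)).mulVec
      (fun j => w (t j)) = 0 := by
    ext i
    have h := hmom i (by omega)
    rw [Finsupp.linearCombination_apply, Finsupp.sum_of_support_subset w hwS _ (by simp)] at h
    rw [← Finset.map_orderEmbOfFin_univ S hSc, Finset.sum_map] at h
    simpa [Matrix.mulVec, dotProduct, mul_comm] using h
  have hzero := Matrix.eq_zero_of_mulVec_eq_zero hdet.ne' hker
  ext r
  by_contra hr
  have hrS : r ∈ Set.range t := by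
    rw [Finset.range_orderEmbOfFin]
    exact hwS (Finsupp.mem_support_iff.2 hr)
  obtain ⟨j, rfl⟩ := hrS
  exact hr (congrFun hzero j)

/-- A signed measure on `n + 2` points, with masses of alternating signs, which annihilates
`1, γ₁, …, γₙ` and is positive on `γₙ₊₁`. -/
lemma HasTotallyPositiveTorsion.exists_alternating {n : ℕ} {γ : ℝ → Fin (n + 1) → ℝ} {a b : ℝ}
    (hγ : HasTotallyPositiveTorsion γ a b) {t : Fin (n + 2) → ℝ}
    (ht : StrictMono t) (htab : ∀ j, t j ∈ Set.Icc a b) :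
    ∃ c : Fin (n + 2) → ℝ, (∀ j, 0 < c j) ∧
      (∀ i ≤ n, ∑ j : Fin (n + 2), (-1) ^ (n + 1 + (j : ℕ)) * c j * chebyshevSystem γ i (t j) = 0) ∧
      0 < ∑ j : Fin (n + 2), (-1) ^ (n + 1 + (j : ℕ)) * c j * chebyshevSystem γ (n + 1) (t j) := by
  let A : Matrix (Fin (n + 2)) (Fin (n + 2)) ℝ :=
    Matrix.of fun i j => chebyshevSystem γ i (t j)
  have hA : 0 < A.det := hγ.det_pos le_rfl ht htab
  -- The masses form the last column of the adjugate: A * adj A = det A • 1 gives zero on every row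
  -- but the last, and det A there. The minors c j are themselves Chebyshev determinants, hence
  -- positive.
  let c : Fin (n + 2) → ℝ := fun j => (A.submatrix (Fin.last (n + 1)).succAbove j.succAbove).det
  have hadj : ∀ j, A.adjugate j (Fin.last (n + 1)) = (-1) ^ (n + 1 + (j : ℕ)) * c j := by
    intro j
    rw [Matrix.adjugate_fin_succ_eq_det_submatrix]
    simp [c]
  have hsum : ∀ i : Fin (n + 2),
      ∑ j : Fin (n + 2), (-1) ^ (n + 1 + (j : ℕ)) * c j * chebyshevSystem γ i (t j) =
        (A * A.adjugate) i (Fin.last (n + 1)) := by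
    intro i
    rw [Matrix.mul_apply]
    refine Finset.sum_congr rfl fun j _ => ?_
    rw [hadj, mul_comm]
    rfl
  refine ⟨c, fun j => ?_, fun i hi => ?_, ?_⟩
  · have h := hγ.det_pos (k := n) (by omega) (ht.comp (Fin.strictMono_succAbove j))
      (fun l => htab _)
    convert h using 2
    ext i l
    simp [A]
  · rw [hsum ⟨i, by omega⟩, Matrix.mul_adjugate, Matrix.smul_apply, Matrix.one_apply_ne]
    · simp
    · intro h
      have := congrArg Fin.val h
      simp at this
      omega
  · have h := hsum (Fin.last (n + 1))
    rw [Matrix.mul_adjugate, Matrix.smul_apply, Matrix.one_apply_eq, smul_eq_mul, mul_one] at h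
    rw [Fin.val_last] at h
    rw [h]
    exact hA

/-! ### Compactness of convex hulls in finite dimension -/

/-- By Carathéodory, dim E + 1 points suffice, so the hull is a continuous image of a compact
simplex times a power of s. Unused slots get weight 0 and the point z₀. -/
lemma isCompact_convexHull_of_finiteDimensional {E : Type*} [NormedAddCommGroup E]
    [NormedSpace ℝ E] [FiniteDimensional ℝ E] {s : Set E} (hs : IsCompact s) :
    IsCompact (convexHull ℝ s) := by
  rcases s.eq_empty_or_nonempty with rfl | ⟨z₀, hz₀⟩
  · simp
  let N := Module.finrank ℝ E + 1
  have himage : convexHull ℝ s = (fun p : (Fin N → ℝ) × (Fin N → E) => ∑ i, p.1 i • p.2 i) ''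
      (stdSimplex ℝ (Fin N) ×ˢ Set.univ.pi fun _ => s) := by
    apply Set.Subset.antisymm
    · intro x hx
      obtain ⟨ι, _, z, w, hz, haff, hw, hw1, hx⟩ := eq_pos_convex_span_of_mem_convexHull hx
      have hcard : Fintype.card ι ≤ Fintype.card (Fin N) := by
        rw [Fintype.card_fin]
        exact haff.card_le_finrank_succ.trans (Nat.succ_le_succ (Submodule.finrank_le _))
      obtain ⟨e⟩ := Function.Embedding.nonempty_of_card_le hcard
      have hw' : ∀ i ∉ Set.range e, Function.extend e w 0 i = 0 := fun i hi =>
        Function.extend_apply' _ _ _ hi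
      refine ⟨⟨Function.extend e w 0, Function.extend e z fun _ => z₀⟩, ⟨⟨fun i => ?_, ?_⟩,
        fun i _ => ?_⟩, ?_⟩
      · by_cases hi : i ∈ Set.range e
        · obtain ⟨j, rfl⟩ := hi
          simpa [e.injective.extend_apply] using (hw j).le
        · exact (hw' i hi).ge
      · rw [← hw1]
        exact (Fintype.sum_of_injective e e.injective _ _ hw' fun i => by
          simp [e.injective.extend_apply]).symm
      · by_cases hi : i ∈ Set.range e
        · obtain ⟨j, rfl⟩ := hi
          simpa [e.injective.extend_apply] using hz ⟨j, rfl⟩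
        · simpa [Function.extend_apply' _ _ _ hi] using hz₀
      · rw [← hx]
        exact (Fintype.sum_of_injective e e.injective _ _ (fun i hi => by simp [hw' i hi])
          fun i => by simp [e.injective.extend_apply]).symm
    · rintro _ ⟨⟨w, z⟩, ⟨hw, hz⟩, rfl⟩
      exact (convex_convexHull ℝ s).sum_mem (fun i _ => hw.1 i) hw.2
        fun i _ => subset_convexHull ℝ s (hz i (Set.mem_univ i))
  rw [himage]
  refine ((isCompact_stdSimplex ℝ (Fin N)).prod (isCompact_univ_pi fun _ => hs)).image ?_
  fun_prop

/-! ### Finitely supported representing measures -/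

/-- `w` is a finitely supported probability measure on `[a,b]` with barycentre `v` along `γ`. -/
structure IsRepresentation {n : ℕ} (γ : ℝ → Fin (n + 1) → ℝ) (a b : ℝ) (w : ℝ →₀ ℝ)
    (v : Fin (n + 1) → ℝ) : Prop where
  nonneg : ∀ r, 0 ≤ w r
  mem_Icc : ∀ r ∈ w.support, r ∈ Set.Icc a b
  total : Finsupp.linearCombination ℝ (fun _ => (1 : ℝ)) w = 1
  barycenter : Finsupp.linearCombination ℝ γ w = v

lemma linearCombination_chebyshevSystem_succ {n : ℕ} (γ : ℝ → Fin (n + 1) → ℝ) (w : ℝ →₀ ℝ)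
    {i : ℕ} (h : i < n + 1) :
    Finsupp.linearCombination ℝ (chebyshevSystem γ (i + 1)) w =
      Finsupp.linearCombination ℝ γ w ⟨i, h⟩ := by
  rw [chebyshevSystem_succ γ h]
  simp [Finsupp.linearCombination_apply, Finsupp.sum, Finset.sum_apply]

lemma isRepresentation_sum_single {n : ℕ} {γ : ℝ → Fin (n + 1) → ℝ} {a b : ℝ} {ι : Type*}
    [Fintype ι] {c z : ι → ℝ} (hc : ∀ i, 0 ≤ c i) (hc1 : ∑ i, c i = 1)
    (hz : ∀ i, z i ∈ Set.Icc a b) :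
    IsRepresentation γ a b (∑ i, Finsupp.single (z i) (c i)) (∑ i, c i • γ (z i)) where
  nonneg r := by
    rw [Finsupp.finsetSum_apply]
    refine Finset.sum_nonneg fun i _ => ?_
    rw [Finsupp.single_apply]
    split_ifs
    exacts [hc i, le_rfl]
  mem_Icc r hr := by
    have h := Finsupp.support_finsetSum hr
    simp only [Finset.mem_biUnion, Finset.mem_univ, true_and] at h
    obtain ⟨i, hi⟩ := h
    rw [Finset.mem_singleton.1 (Finsupp.support_single_subset hi)]
    exact hz i
  total := by simpa [map_sum] using hc1
  barycenter := by simp [map_sum]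

lemma IsRepresentation.mem_convexHull {n : ℕ} {γ : ℝ → Fin (n + 1) → ℝ} {a b : ℝ} {w : ℝ →₀ ℝ}
    {v : Fin (n + 1) → ℝ} (h : IsRepresentation γ a b w v) :
    v ∈ convexHull ℝ (γ '' Set.Icc a b) := by
  have ht := h.total
  rw [← h.barycenter]
  simp only [Finsupp.linearCombination_apply, Finsupp.sum, smul_eq_mul, mul_one] at ht ⊢
  exact (convex_convexHull ℝ _).sum_mem (fun r _ => h.nonneg r) ht
    fun r hr => subset_convexHull ℝ _ ⟨r, h.mem_Icc r hr, rfl⟩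

lemma exists_isRepresentation {n : ℕ} {γ : ℝ → Fin (n + 1) → ℝ} {a b : ℝ}
    {v : Fin (n + 1) → ℝ} (hv : v ∈ convexHull ℝ (γ '' Set.Icc a b)) :
    ∃ w, IsRepresentation γ a b w v := by
  obtain ⟨ι, _, z, c, hz, -, hc, hc1, rfl⟩ := eq_pos_convex_span_of_mem_convexHull hv
  choose s hs hsz using fun i => hz ⟨i, rfl⟩
  exact ⟨_, by simpa [hsz] using isRepresentation_sum_single (γ := γ) (fun i => (hc i).le) hc1 hs⟩

/-- A representing measure charging every node of negative mass of the alternating measure on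
`t₀ < ⋯ < tₙ₊₁` does not have an extremal last coordinate. -/
lemma IsRepresentation.exists_lt {n : ℕ} {γ : ℝ → Fin (n + 1) → ℝ} {a b : ℝ}
    (hγ : HasTotallyPositiveTorsion γ a b) {w : ℝ →₀ ℝ} {v : Fin (n + 1) → ℝ}
    (hw : IsRepresentation γ a b w v) (p : ℕ) {t : Fin (n + 2) → ℝ} (ht : StrictMono t)
    (htab : ∀ j, t j ∈ Set.Icc a b)
    (hneg : ∀ j : Fin (n + 2), Odd (n + 1 + (j : ℕ) + p) → t j ∈ w.support) :
    ∃ v' ∈ convexHull ℝ (γ '' Set.Icc a b), bar v' = bar v ∧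
      (-1) ^ p * lastCoord v < (-1) ^ p * lastCoord v' := by
  obtain ⟨c, hc, hzero, hpos⟩ := hγ.exists_alternating ht htab
  -- The factor (-1)^p turns the alternating measure into an improving direction for maxima (p even)
  -- or minima (p odd).
  let σ : ℝ →₀ ℝ := ∑ j, Finsupp.single (t j) ((-1) ^ (n + 1 + (j : ℕ) + p) * c j)
  have hσ : ∀ i, Finsupp.linearCombination ℝ (chebyshevSystem γ i) σ = (-1) ^ p *
      ∑ j : Fin (n + 2), (-1) ^ (n + 1 + (j : ℕ)) * c j * chebyshevSystem γ i (t j) := by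
    intro i
    simp only [σ, map_sum, Finsupp.linearCombination_single, smul_eq_mul, Finset.mul_sum]
    exact Finset.sum_congr rfl fun j _ => by ring
  have hσt : ∀ j, σ (t j) = (-1) ^ (n + 1 + (j : ℕ) + p) * c j := by
    intro j
    simp [σ, Finsupp.finsetSum_apply, Finsupp.single_apply, ht.injective.eq_iff]
  have hσsupp : ∀ r ∈ σ.support, ∃ j, t j = r := by
    intro r hr
    have h := Finsupp.support_finsetSum hr
    simp only [Finset.mem_biUnion, Finset.mem_univ, true_and] at h
    obtain ⟨j, hj⟩ := h
    exact ⟨j, (Finset.mem_singleton.1 (Finsupp.support_single_subset hj)).symm⟩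
  have hσneg : ∀ r, σ r < 0 → 0 < w r := by
    intro r hr
    obtain ⟨j, rfl⟩ := hσsupp r (Finsupp.mem_support_iff.2 hr.ne)
    refine (hw.nonneg _).lt_of_ne' (Finsupp.mem_support_iff.1 (hneg j ?_))
    by_contra hodd
    rw [Nat.not_odd_iff_even] at hodd
    rw [hσt, hodd.neg_one_pow, one_mul] at hr
    exact hr.not_gt (hc j)
  -- Finitely many conditions, each true for small δ > 0, since w is positive wherever σ is
  -- negative.
  obtain ⟨δ, hδ, hδ0⟩ : ∃ δ : ℝ, (∀ r ∈ σ.support, 0 ≤ w r + δ * σ r) ∧ 0 < δ := by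
    have hev : ∀ᶠ δ in nhdsWithin (0 : ℝ) (Set.Ioi 0), ∀ r ∈ σ.support, 0 ≤ w r + δ * σ r := by
      rw [Filter.eventually_all_finset]
      intro r _
      rcases lt_or_ge (σ r) 0 with hr | hr
      · refine Filter.Eventually.filter_mono nhdsWithin_le_nhds ?_
        have hcont : Continuous fun δ : ℝ => w r + δ * σ r := by fun_prop
        exact (hcont.continuousAt.eventually (lt_mem_nhds (by simpa using hσneg r hr))).mono
          fun _ h => le_of_lt h
      · filter_upwards [self_mem_nhdsWithin] with δ hδ
        exact add_nonneg (hw.nonneg r) (mul_nonneg (le_of_lt hδ) hr)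
    exact (hev.and self_mem_nhdsWithin).exists
  have hlin : ∀ i, i ≤ n → Finsupp.linearCombination ℝ (chebyshevSystem γ i) (w + δ • σ) =
      Finsupp.linearCombination ℝ (chebyshevSystem γ i) w := by
    intro i hi
    rw [map_add, map_smul, hσ, hzero i hi]
    simp
  have hrep : IsRepresentation γ a b (w + δ • σ)
      (Finsupp.linearCombination ℝ γ (w + δ • σ)) := by
    refine ⟨fun r => ?_, fun r hr => ?_, ?_, rfl⟩
    · by_cases hr : r ∈ σ.support
      · simpa using hδ r hr
      · simpa [Finsupp.notMem_support_iff.1 hr] using hw.nonneg r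
    · rcases Finset.mem_union.1 (Finsupp.support_add hr) with h | h
      · exact hw.mem_Icc r h
      · obtain ⟨j, rfl⟩ := hσsupp r (Finsupp.support_smul h)
        exact htab j
    · exact (hlin 0 (Nat.zero_le _)).trans hw.total
  refine ⟨_, hrep.mem_convexHull, ?_, ?_⟩
  · ext i
    have h := hlin (i + 1) i.2
    rw [linearCombination_chebyshevSystem_succ γ _ (by omega),
      linearCombination_chebyshevSystem_succ γ _ (by omega), hw.barycenter] at h
    exact h
  · have h1 := linearCombination_chebyshevSystem_succ γ (w + δ • σ) (Nat.lt_succ_self n)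
    have h2 := linearCombination_chebyshevSystem_succ γ w (Nat.lt_succ_self n)
    rw [map_add, map_smul, h2, hw.barycenter, hσ] at h1
    have h3 : lastCoord (Finsupp.linearCombination ℝ γ (w + δ • σ)) = _ := h1.symm
    have h4 : ((-1 : ℝ) ^ p) * (-1) ^ p = 1 := by rw [← mul_pow]; simp
    rw [h3, mul_add, smul_eq_mul]
    have h5 := mul_pos hδ0 hpos
    have h6 : (-1 : ℝ) ^ p * (δ * ((-1) ^ p * ∑ j : Fin (n + 2),
        (-1) ^ (n + 1 + (j : ℕ)) * c j * chebyshevSystem γ (n + 1) (t j))) =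
        δ * ∑ j : Fin (n + 2), (-1) ^ (n + 1 + (j : ℕ)) * c j *
          chebyshevSystem γ (n + 1) (t j) := by
      linear_combination (δ * ∑ j : Fin (n + 2), (-1) ^ (n + 1 + (j : ℕ)) * c j *
          chebyshevSystem γ (n + 1) (t j)) * h4
    rw [h6]
    exact lt_add_of_pos_right _ h5

/-- Interlacing: more than `m` points of `[a,b]` can be completed to an increasing sequence of
`N` points in which they occupy every second place. -/
lemma exists_strictMono_interlacing {a b : ℝ} (hab : a ≤ b) {S : Finset ℝ}
    (hS : ∀ r ∈ S, r ∈ Set.Icc a b) {m N k : ℕ} (hm : m < S.card) (hk : 1 ≤ k)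
    (hN : N + k ≤ 2 * m + 4) (ha : k = 1 → a ∉ S) (hb : N + k = 2 * m + 4 → b ∉ S) :
    ∃ t : Fin N → ℝ, StrictMono t ∧ (∀ j, t j ∈ Set.Icc a b) ∧
      ∀ j : Fin N, Even ((j : ℕ) + k) → t j ∈ S := by
  obtain ⟨S', hS', hcard⟩ := Finset.exists_subset_card_eq (Nat.succ_le_of_lt hm)
  let s := S'.orderEmbOfFin hcard
  have hsS : ∀ i, s i ∈ S := fun i => hS' (Finset.orderEmbOfFin_mem S' hcard i)
  -- The sequence a, s₀, …, s_m, b, b, ….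
  let e : ℕ → ℝ
    | 0 => a
    | i + 1 => if h : i < m.succ then s ⟨i, h⟩ else b
  have he : ∀ i, e i ∈ Set.Icc a b := by
    rintro (_ | i)
    · exact ⟨le_rfl, hab⟩
    · simp only [e]
      split_ifs with h
      · exact hS _ (hsS _)
      · exact ⟨hab, le_rfl⟩
  have hlt : ∀ q, (q = 0 → k = 1) → (q = m + 1 → N + k = 2 * m + 4) → q ≤ m + 1 →
      e q < e (q + 1) := by
    rintro (_ | q) h0 h1 hq
    · have h := hS _ (hsS ⟨0, m.succ_pos⟩)
      simp only [e, m.succ_pos, dif_pos]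
      exact h.1.lt_of_ne fun h' => ha (h0 rfl) (h' ▸ hsS _)
    · have hq' : q < m.succ := by omega
      by_cases hq1 : q + 1 < m.succ
      · simp only [e, hq', hq1, dif_pos]
        exact s.strictMono (Fin.mk_lt_mk.2 q.lt_succ_self)
      · simp only [e, hq', hq1, dif_pos, dif_neg, not_false_iff]
        have h := hS _ (hsS ⟨q, hq'⟩)
        exact h.2.lt_of_ne fun h' => hb (h1 (by omega)) (h' ▸ hsS _)
  -- Even indices give the terms of e, odd ones the midpoints between neighbours. The window starts
  -- at index k: for k = 1 it uses the gap after a, and if it ends at 2m + 3 it uses the gap before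
  -- b; these gaps must be nondegenerate.
  let T : ℕ → ℝ := fun i => (e (i / 2) + e ((i + 1) / 2)) / 2
  have hT : ∀ i, k ≤ i → i + 1 < N + k → T i < T (i + 1) := by
    intro i hi hi'
    have h := hlt (i / 2) (by omega) (by omega) (by omega)
    have h2 : (i + 1 + 1) / 2 = i / 2 + 1 := by omega
    simp only [T, h2]
    linarith
  refine ⟨fun j => T (j + k), ?_, fun j => ?_, fun j hj => ?_⟩
  · cases N with
    | zero => exact fun i => i.elim0
    | succ N =>
      rw [Fin.strictMono_iff_lt_succ]
      intro i
      have h := hT (i + k) (by omega) (by omega)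
      simpa [add_right_comm] using h
  · have h1 := he ((j + k) / 2)
    have h2 := he ((j + k + 1) / 2)
    exact ⟨by simp only [T]; linarith [h1.1, h2.1], by simp only [T]; linarith [h1.2, h2.2]⟩
  · obtain ⟨q, hq⟩ := hj
    obtain ⟨q, rfl⟩ : ∃ q', q = q' + 1 := ⟨q - 1, by omega⟩
    have h1 : (j + k) / 2 = q + 1 := by omega
    have h2 : (j + k + 1) / 2 = q + 1 := by omega
    have h3 : q < m.succ := by omega
    simp only [T, h1, h2, add_self_div_two]
    simp only [e, h3, dif_pos]
    exact hsS _

/-! ### Extremality and the shape of the support -/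

/-- The supports of extremal measures: arbitrary masses at the endpoints in `E` and at most `m`
other points. The parity of `p` tells maximal (`p` even) from minimal measures. -/
structure IsExtremalShape (n : ℕ) (a b : ℝ) (p m : ℕ) (E : Finset ℝ) : Prop where
  card_le : E.card + 2 * m ≤ n + 1
  exists_offset : ∃ k, 1 ≤ k ∧ Even (n + p + k) ∧ n + 2 + k ≤ 2 * m + 4 ∧ (k = 1 → a ∈ E) ∧
    (n + 2 + k = 2 * m + 4 → b ∈ E)

/-- The two supports together have at most |E| + 2m ≤ n + 1 points, too few for a nonzero difference
with vanishing moments. -/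
lemma IsRepresentation.eq_of_bar_eq {n : ℕ} {γ : ℝ → Fin (n + 1) → ℝ} {a b : ℝ} (hab : a < b)
    (hγ : HasTotallyPositiveTorsion γ a b) {p m : ℕ} {E : Finset ℝ}
    (hE : IsExtremalShape n a b p m E) {w w' : ℝ →₀ ℝ} {v v' : Fin (n + 1) → ℝ}
    (hw : IsRepresentation γ a b w v) (hw' : IsRepresentation γ a b w' v')
    (hcard : (w.support \ E).card ≤ m) (hcard' : (w'.support \ E).card ≤ m)
    (hbar : bar v = bar v') : v = v' := by
  have hsub : (w - w').support ⊆ E ∪ (w.support \ E ∪ w'.support \ E) := by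
    intro r hr
    have h := Finsupp.support_sub hr
    by_cases hrE : r ∈ E <;> simp_all
  have hzero : w - w' = 0 := by
    refine hγ.eq_zero_of_moments hab (fun r hr => ?_) ?_ fun i hi => ?_
    · rcases Finset.mem_union.1 (Finsupp.support_sub hr) with h | h
      exacts [hw.mem_Icc r h, hw'.mem_Icc r h]
    · have h1 := Finset.card_le_card hsub
      have h2 := Finset.card_union_le E (w.support \ E ∪ w'.support \ E)
      have h3 := Finset.card_union_le (w.support \ E) (w'.support \ E)
      have h4 := hE.card_le
      omega
    · rw [map_sub, sub_eq_zero]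
      cases i with
      | zero => exact hw.total.trans hw'.total.symm
      | succ i =>
        rw [linearCombination_chebyshevSystem_succ γ _ (by omega),
          linearCombination_chebyshevSystem_succ γ _ (by omega), hw.barycenter, hw'.barycenter]
        exact congrFun hbar ⟨i, hi⟩
  rw [← hw.barycenter, ← hw'.barycenter, sub_eq_zero.1 hzero]

/-- With more than m atoms outside E, interlacing gives n + 2 nodes that are atoms whenever j + k is
even. Since n + p + k is even, these are exactly the nodes of negative mass, so
`IsRepresentation.exists_lt` contradicts extremality. -/
lemma IsRepresentation.card_support_sdiff_le {n : ℕ} {γ : ℝ → Fin (n + 1) → ℝ} {a b : ℝ}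
    (hab : a < b) (hγ : HasTotallyPositiveTorsion γ a b) {p m : ℕ} {E : Finset ℝ}
    (hE : IsExtremalShape n a b p m E) {w : ℝ →₀ ℝ} {v : Fin (n + 1) → ℝ}
    (hw : IsRepresentation γ a b w v)
    (hmax : ∀ v' ∈ convexHull ℝ (γ '' Set.Icc a b), bar v' = bar v →
      (-1) ^ p * lastCoord v' ≤ (-1) ^ p * lastCoord v) :
    (w.support \ E).card ≤ m := by
  by_contra! hm
  obtain ⟨k, hk, heven, hN, ha, hb⟩ := hE.exists_offset
  obtain ⟨t, ht, htab, htS⟩ := exists_strictMono_interlacing hab.le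
    (fun r hr => hw.mem_Icc r (Finset.sdiff_subset hr)) hm hk hN
    (fun h => by simp [ha h]) (fun h => by simp [hb h])
  obtain ⟨v', hv', hbar, hlt⟩ := hw.exists_lt hγ p ht htab fun j hj =>
    Finset.sdiff_subset (htS j (by
      rw [Nat.odd_iff] at hj
      rw [Nat.even_iff] at heven ⊢
      omega))
  exact (hmax v' hv' hbar).not_gt hlt

lemma bar_image_convexHull {n : ℕ} (γ : ℝ → Fin (n + 1) → ℝ) (s : Set ℝ) :
    bar '' convexHull ℝ (γ '' s) = convexHull ℝ ((fun t => bar (γ t)) '' s) := by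
  have h := (LinearMap.funLeft ℝ ℝ (Fin.castSucc : Fin n → Fin (n + 1))).image_convexHull (γ '' s)
  rw [Set.image_image] at h
  exact h

lemma isCompact_convexHull_image {n : ℕ} {γ : ℝ → Fin (n + 1) → ℝ} {a b : ℝ}
    (hγ : HasTotallyPositiveTorsion γ a b) : IsCompact (convexHull ℝ (γ '' Set.Icc a b)) :=
  isCompact_convexHull_of_finiteDimensional (isCompact_Icc.image_of_continuousOn hγ.continuousOn)

/-- Over every point of the convex hull of `γ̄` there is an extremal point which is represented by
a measure of the given shape. -/
lemma exists_extremal_representation {n : ℕ} {γ : ℝ → Fin (n + 1) → ℝ} {a b : ℝ} (hab : a < b)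
    (hγ : HasTotallyPositiveTorsion γ a b) {p m : ℕ} {E : Finset ℝ}
    (hE : IsExtremalShape n a b p m E) {x : Fin n → ℝ}
    (hx : x ∈ convexHull ℝ ((fun t => bar (γ t)) '' Set.Icc a b)) :
    ∃ w v, IsRepresentation γ a b w v ∧ bar v = x ∧ (w.support \ E).card ≤ m ∧
      ∀ v' ∈ convexHull ℝ (γ '' Set.Icc a b), bar v' = x →
        (-1) ^ p * lastCoord v' ≤ (-1) ^ p * lastCoord v := by
  have hbar : Continuous (bar : (Fin (n + 1) → ℝ) → Fin n → ℝ) :=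
    continuous_pi fun i => continuous_apply i.castSucc
  have hlast : Continuous fun v : Fin (n + 1) → ℝ => (-1) ^ p * lastCoord v :=
    continuous_const.mul (continuous_apply (Fin.last n))
  have hcomp : IsCompact (convexHull ℝ (γ '' Set.Icc a b) ∩ bar ⁻¹' {x}) :=
    (isCompact_convexHull_image hγ).inter_right (isClosed_singleton.preimage hbar)
  rw [← bar_image_convexHull] at hx
  obtain ⟨v₀, hv₀, hv₀x⟩ := hx
  obtain ⟨v, ⟨hvK, hvx⟩, hmax⟩ := hcomp.exists_isMaxOn ⟨v₀, hv₀, hv₀x⟩ hlast.continuousOn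
  obtain ⟨w, hw⟩ := exists_isRepresentation hvK
  have hvx : bar v = x := hvx
  have hmax' : ∀ v' ∈ convexHull ℝ (γ '' Set.Icc a b), bar v' = x →
      (-1) ^ p * lastCoord v' ≤ (-1) ^ p * lastCoord v := fun v' h1 h2 => hmax ⟨h1, h2⟩
  exact ⟨w, v, hw, hvx, hw.card_support_sdiff_le hab hγ hE (by simpa [hvx] using hmax'), hmax'⟩

/-- A measure of the given shape is extremal. -/
lemma IsRepresentation.le_of_card_le {n : ℕ} {γ : ℝ → Fin (n + 1) → ℝ} {a b : ℝ} (hab : a < b)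
    (hγ : HasTotallyPositiveTorsion γ a b) {p m : ℕ} {E : Finset ℝ}
    (hE : IsExtremalShape n a b p m E) {w : ℝ →₀ ℝ} {v v' : Fin (n + 1) → ℝ}
    (hw : IsRepresentation γ a b w v) (hcard : (w.support \ E).card ≤ m)
    (hv' : v' ∈ convexHull ℝ (γ '' Set.Icc a b)) (hbar : bar v' = bar v) :
    (-1) ^ p * lastCoord v' ≤ (-1) ^ p * lastCoord v := by
  have hx : bar v ∈ convexHull ℝ ((fun t => bar (γ t)) '' Set.Icc a b) := by
    rw [← bar_image_convexHull]
    exact ⟨v, hw.mem_convexHull, rfl⟩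
  -- An extremal law of the same shape exists over the same point; by uniqueness the given
  -- barycentre is the extremal one.
  obtain ⟨w₁, v₁, hw₁, hv₁, hcard₁, hmax⟩ := exists_extremal_representation hab hγ hE hx
  rw [hw.eq_of_bar_eq hab hγ hE hw₁ hcard hcard₁ hv₁.symm]
  exact hmax v' hv' hbar

/-- The nodes outside `E` of a measure of the given shape, filled up with nodes of mass zero. -/
lemma IsRepresentation.exists_nodes {n : ℕ} {γ : ℝ → Fin (n + 1) → ℝ} {a b : ℝ} (hab : a < b)
    {m : ℕ} {E : Finset ℝ} {w : ℝ →₀ ℝ} {v : Fin (n + 1) → ℝ}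
    (hw : IsRepresentation γ a b w v) (hcard : (w.support \ E).card ≤ m) :
    ∃ y ∈ simplexStar a b m, ∑ r ∈ E, w r + ∑ j, w (y j) = 1 ∧
      v = ∑ r ∈ E, w r • γ r + ∑ j, w (y j) • γ (y j) := by
  -- The padding avoids E, so that no mass is counted twice.
  obtain ⟨S, hwS, hS, hSc⟩ :=
    ((Set.Icc_infinite hab).sdiff E.finite_toSet).exists_finset_superset_card_eq
      (s := w.support \ E)
      (fun r hr => by
        have hr' := Finset.mem_sdiff.1 (Finset.mem_coe.1 hr)
        exact ⟨hw.mem_Icc r hr'.1, by simpa using hr'.2⟩) hcard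
  let y := S.orderEmbOfFin hSc
  have hdisj : Disjoint E S := Finset.disjoint_right.2 fun r hr => by
    simpa using (hS (Finset.mem_coe.2 hr)).2
  have hsupp : w.support ⊆ E ∪ S := by
    intro r hr
    by_cases hrE : r ∈ E
    · exact Finset.mem_union_left _ hrE
    · exact Finset.mem_union_right _ (hwS (Finset.mem_sdiff.2 ⟨hr, hrE⟩))
  have hsum : ∀ {V : Type} [AddCommGroup V] [Module ℝ V] (g : ℝ → V),
      Finsupp.linearCombination ℝ g w = ∑ r ∈ E, w r • g r + ∑ j, w (y j) • g (y j) := by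
    intro V _ _ g
    rw [Finsupp.linearCombination_apply, Finsupp.sum_of_support_subset w hsupp _ (by simp),
      Finset.sum_union hdisj, ← Finset.map_orderEmbOfFin_univ S hSc, Finset.sum_map]
    rfl
  refine ⟨y, ⟨fun j => (hS (Finset.orderEmbOfFin_mem S hSc j)).1, y.monotone⟩, ?_, ?_⟩
  · simpa using (hsum fun _ => (1 : ℝ)).symm.trans hw.total
  · rw [← hsum, hw.barycenter]

/-! ### Random variables -/

/-- The expectation of `γ(Y)` lies in the convex hull of the curve. -/
lemma exists_mem_convexHull_of_mem_momentValues {n : ℕ} {γ : ℝ → Fin (n + 1) → ℝ} {a b : ℝ}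
    (hγ : HasTotallyPositiveTorsion γ a b) {x : Fin n → ℝ} {z : ℝ}
    (hz : z ∈ momentValues.{u} γ a b x) :
    ∃ v ∈ convexHull ℝ (γ '' Set.Icc a b), bar v = x ∧ lastCoord v = z := by
  obtain ⟨Ω, _, P, _, Y, hY, rfl⟩ := hz
  -- Y itself need not be measurable; only γ(Y) is integrated.
  have hmeas : Measurable fun ω => γ (Y ω) := measurable_pi_iff.2 hY.measurable
  have hmem : ∀ ω, γ (Y ω) ∈ γ '' Set.Icc a b := fun ω => ⟨_, (Y ω).2, rfl⟩
  obtain ⟨C, hC⟩ := (isCompact_Icc.image_of_continuousOn hγ.continuousOn).isBounded.exists_norm_le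
  have hint : Integrable (fun ω => γ (Y ω)) P :=
    Integrable.of_bound hmeas.aestronglyMeasurable C (.of_forall fun ω => hC _ (hmem ω))
  have heval : ∀ i, (∫ ω, γ (Y ω) ∂P) i = ∫ ω, γ (Y ω) i ∂P :=
    eval_integral fun i => hint.eval i
  refine ⟨∫ ω, γ (Y ω) ∂P, (convex_convexHull ℝ _).integral_mem
    (isCompact_convexHull_image hγ).isClosed
    (.of_forall fun ω => subset_convexHull ℝ _ (hmem ω)) hint, ?_, heval _⟩
  ext i
  rw [← hY.moments i]
  exact heval _

/-- A discrete law on `[a,b]` is the law of a random variable, and each random variable with this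
law has the barycentre of the law as moment vector. -/
lemma attainedByLaw_sum_dirac {n : ℕ} {γ : ℝ → Fin (n + 1) → ℝ} {a b : ℝ} (hab : a ≤ b)
    (hγ : ContinuousOn γ (Set.Icc a b)) {ι : Type*} [Fintype ι] {c z : ι → ℝ}
    (hc : ∀ i, 0 ≤ c i) (hc1 : ∑ i, c i = 1) (hz : ∀ i, z i ∈ Set.Icc a b) :
    AttainedByLaw.{u} γ a b (bar (∑ i, c i • γ (z i)))
      (∑ i, ENNReal.ofReal (c i) • Measure.dirac (z i)) (lastCoord (∑ i, c i • γ (z i))) := by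
  constructor
  · refine ⟨ULift.{u} (Set.Icc a b), inferInstance,
      ∑ i, ENNReal.ofReal (c i) • Measure.dirac (ULift.up ⟨z i, hz i⟩), ⟨?_⟩, ULift.down,
      measurable_down, ?_⟩
    · rw [Measure.finsetSum_apply]
      simp only [Measure.smul_apply, measure_univ, smul_eq_mul, mul_one]
      rw [← ENNReal.ofReal_sum_of_nonneg fun i _ => hc i, hc1, ENNReal.ofReal_one]
    · have hm : Measurable fun ω : ULift.{u} (Set.Icc a b) => (ω.down : ℝ) :=
        measurable_subtype_coe.comp measurable_down
      rw [← Measure.mapₗ_apply_of_measurable hm, map_sum]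
      refine Finset.sum_congr rfl fun i _ => ?_
      rw [Measure.mapₗ_apply_of_measurable hm, Measure.map_smul, Measure.map_dirac' hm]
  · intro Ω _ P _ ζ hζ hlaw
    -- γ is controlled only on [a,b]; its extension by constants is measurable on ℝ, so integrals
    -- can be computed from the law.
    have hext : ∀ i, Continuous (Set.IccExtend hab ((Set.Icc a b).domRestrict fun t => γ t i)) :=
      fun i => (continuousOn_iff_continuous_domRestrict.1 (continuousOn_pi.1 hγ i)).Icc_extend'
    have hval : ∀ i, ∀ t ∈ Set.Icc a b,
        Set.IccExtend hab ((Set.Icc a b).domRestrict fun t => γ t i) t = γ t i :=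
      fun i t ht => Set.IccExtend_of_mem hab _ ht
    have hζ' : Measurable fun ω => (ζ ω : ℝ) := measurable_subtype_coe.comp hζ
    have hmeas : ∀ i, Measurable fun ω => γ (ζ ω) i := by
      intro i
      have h := (hext i).measurable.comp hζ'
      simpa only [Function.comp_def, hval i _ (ζ _).2] using h
    have hintegral : ∀ i, ∫ ω, γ (ζ ω) i ∂P = (∑ j, c j • γ (z j)) i := by
      intro i
      have h := integral_map hζ'.aemeasurable
        (μ := P) (hext i).measurable.aestronglyMeasurable
      simp only [hval i _ (ζ _).2] at h
      rw [← h, hlaw, integral_finsetSum_measure]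
      · rw [Finset.sum_apply]
        refine Finset.sum_congr rfl fun j _ => ?_
        rw [integral_smul_measure, integral_dirac, hval i _ (hz j), ENNReal.toReal_ofReal (hc j)]
        rfl
      · intro j _
        exact (integrable_dirac (by simp)).smul_measure ENNReal.ofReal_ne_top
    exact ⟨⟨hmeas, fun j => hintegral _⟩, hintegral _⟩

/-- Any value attained by a law is a moment value. -/
lemma AttainedByLaw.mem_momentValues {n : ℕ} {γ : ℝ → Fin (n + 1) → ℝ} {a b : ℝ}
    {x : Fin n → ℝ} {μ : Measure ℝ} {v : ℝ} (h : AttainedByLaw.{u} γ a b x μ v) :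
    v ∈ momentValues.{u} γ a b x := by
  obtain ⟨⟨Ω, _, P, hP, ζ, hζ, hlaw⟩, hall⟩ := h
  obtain ⟨hcomp, hint⟩ := hall Ω P ζ hζ hlaw
  exact ⟨Ω, _, P, hP, ζ, hcomp, hint⟩

/-! ### Parametrizations of the extremal measures -/

/-- `W` parametrizes by `D` the upper (`p` even) or lower (`p` odd) part of the boundary of the
convex hull of `γ`, and `law q` is a law with barycentre `W q`. -/
structure IsExtremalParametrization {n : ℕ} (γ : ℝ → Fin (n + 1) → ℝ) (a b : ℝ) (p : ℕ)
    {Q : Type*} (D : Set Q) (W : Q → Fin (n + 1) → ℝ) (law : Q → Measure ℝ) : Prop where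
  mem_convexHull : ∀ q ∈ D, W q ∈ convexHull ℝ (γ '' Set.Icc a b)
  surjective : ∀ x ∈ convexHull ℝ ((fun t => bar (γ t)) '' Set.Icc a b), ∃ q ∈ D, x = bar (W q)
  extremal : ∀ q ∈ D, ∀ v ∈ convexHull ℝ (γ '' Set.Icc a b), bar v = bar (W q) →
    (-1) ^ p * lastCoord v ≤ (-1) ^ p * lastCoord (W q)
  attained : ∀ q ∈ D, AttainedByLaw.{u} γ a b (bar (W q)) (law q) (lastCoord (W q))

section Parametrization

variable {n : ℕ} {γ : ℝ → Fin (n + 1) → ℝ} {a b : ℝ} {p : ℕ} {Q : Type*} {D : Set Q}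
  {W : Q → Fin (n + 1) → ℝ} {law : Q → Measure ℝ}

/-- Reduces each family to two checks: parameters give laws of the right shape, and every
distribution of mass on E and m ordered nodes comes from a parameter. -/
lemma IsExtremalShape.isExtremalParametrization (hab : a < b)
    (hγ : HasTotallyPositiveTorsion γ a b) {m : ℕ} {E : Finset ℝ}
    (hE : IsExtremalShape n a b p m E)
    (hD : ∀ q ∈ D, ∃ (ι : Type) (_ : Fintype ι) (c z : ι → ℝ), (∀ i, 0 ≤ c i) ∧ ∑ i, c i = 1 ∧
      (∀ i, z i ∈ Set.Icc a b) ∧ (∃ y : Fin m → ℝ, ∀ i, z i ∈ E ∨ ∃ j, z i = y j) ∧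
      W q = ∑ i, c i • γ (z i) ∧ law q = ∑ i, ENNReal.ofReal (c i) • Measure.dirac (z i))
    (hsurj : ∀ (w : ℝ →₀ ℝ) (y : Fin m → ℝ), (∀ r, 0 ≤ w r) → y ∈ simplexStar a b m →
      ∑ r ∈ E, w r + ∑ j, w (y j) = 1 →
      ∃ q ∈ D, W q = ∑ r ∈ E, w r • γ r + ∑ j, w (y j) • γ (y j)) :
    IsExtremalParametrization.{u} γ a b p D W law where
  mem_convexHull q hq := by
    obtain ⟨ι, _, c, z, hc, hc1, hz, -, hW, -⟩ := hD q hq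
    rw [hW]
    exact (isRepresentation_sum_single hc hc1 hz).mem_convexHull
  surjective x hx := by
    obtain ⟨w, v, hw, hvx, hcard, -⟩ := exists_extremal_representation hab hγ hE hx
    obtain ⟨y, hy, hsum, hv⟩ := hw.exists_nodes hab hcard
    obtain ⟨q, hq, hWq⟩ := hsurj w y hw.nonneg hy hsum
    exact ⟨q, hq, by rw [hWq, ← hv, hvx]⟩
  extremal q hq v hv hbar := by
    obtain ⟨ι, _, c, z, hc, hc1, hz, ⟨y, hy⟩, hW, -⟩ := hD q hq
    rw [hW] at hbar ⊢
    refine (isRepresentation_sum_single hc hc1 hz).le_of_card_le hab hγ hE ?_ hv hbar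
    have hsub : (∑ i, Finsupp.single (z i) (c i)).support \ E ⊆ Finset.univ.image y := by
      intro r hr
      rw [Finset.mem_sdiff] at hr
      have h := Finsupp.support_finsetSum hr.1
      simp only [Finset.mem_biUnion, Finset.mem_univ, true_and] at h
      obtain ⟨i, hi⟩ := h
      obtain rfl := Finset.mem_singleton.1 (Finsupp.support_single_subset hi)
      obtain ⟨j, hj⟩ := (hy i).resolve_left hr.2
      exact Finset.mem_image.2 ⟨j, Finset.mem_univ j, hj.symm⟩
    calc _ ≤ (Finset.univ.image y).card := Finset.card_le_card hsub
      _ ≤ m := by simpa using Finset.card_image_le (s := Finset.univ) (f := y)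
  attained q hq := by
    obtain ⟨ι, _, c, z, hc, hc1, hz, -, hW, hlaw⟩ := hD q hq
    rw [hW, hlaw]
    exact attainedByLaw_sum_dirac hab.le hγ.continuousOn hc hc1 hz

namespace IsExtremalParametrization

/-- Two parameters over the same point are both extremal there, so their last coordinates bound each
other. -/
lemma graphFunction_bar (h : IsExtremalParametrization.{u} γ a b p D W law) {q : Q} (hq : q ∈ D) :
    graphFunction D W (bar (W q)) = lastCoord (W q) := by
  have hfac : Function.FactorsThrough (fun p : D => lastCoord (W p)) (fun p : D => bar (W p)) := by
    intro q₁ q₂ hbar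
    have h1 := h.extremal q₁ q₁.2 _ (h.mem_convexHull q₂ q₂.2) hbar.symm
    have h2 := h.extremal q₂ q₂.2 _ (h.mem_convexHull q₁ q₁.2) hbar
    exact mul_left_cancel₀ (pow_ne_zero p (by norm_num)) (h2.antisymm h1)
  exact hfac.extend_apply 0 ⟨q, hq⟩

lemma attainedByLaw (h : IsExtremalParametrization.{u} γ a b p D W law) {q : Q} (hq : q ∈ D) :
    AttainedByLaw.{u} γ a b (bar (W q)) (law q) (graphFunction D W (bar (W q))) := by
  rw [h.graphFunction_bar hq]
  exact h.attained q hq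

lemma isLUB (hγ : HasTotallyPositiveTorsion γ a b)
    (h : IsExtremalParametrization.{u} γ a b 0 D W law) {x : Fin n → ℝ}
    (hx : x ∈ convexHull ℝ ((fun t => bar (γ t)) '' Set.Icc a b)) :
    IsLUB (momentValues.{u} γ a b x) (graphFunction D W x) := by
  obtain ⟨q, hq, rfl⟩ := h.surjective x hx
  refine IsGreatest.isLUB ⟨(h.attainedByLaw hq).mem_momentValues, fun z hz => ?_⟩
  obtain ⟨v, hv, hbar, rfl⟩ := exists_mem_convexHull_of_mem_momentValues hγ hz
  rw [h.graphFunction_bar hq]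
  simpa using h.extremal q hq v hv hbar

lemma isGLB (hγ : HasTotallyPositiveTorsion γ a b)
    (h : IsExtremalParametrization.{u} γ a b 1 D W law) {x : Fin n → ℝ}
    (hx : x ∈ convexHull ℝ ((fun t => bar (γ t)) '' Set.Icc a b)) :
    IsGLB (momentValues.{u} γ a b x) (graphFunction D W x) := by
  obtain ⟨q, hq, rfl⟩ := h.surjective x hx
  refine IsLeast.isGLB ⟨(h.attainedByLaw hq).mem_momentValues, fun z hz => ?_⟩
  obtain ⟨v, hv, hbar, rfl⟩ := exists_mem_convexHull_of_mem_momentValues hγ hz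
  rw [h.graphFunction_bar hq]
  simpa using h.extremal q hq v hv hbar

end IsExtremalParametrization

end Parametrization

/-! ### The four families of extremal measures -/

/-- With offset 2 the nodes begin at an atom and end with a positive mass in the gap before b, so b
must be exempt. -/
lemma isExtremalParametrization_upperEven {n : ℕ} {γ : ℝ → Fin (n + 1) → ℝ} {a b : ℝ}
    (hab : a < b) (hγ : HasTotallyPositiveTorsion γ a b) (hn : Even n) :
    IsExtremalParametrization.{u} γ a b 0 (simplexC (n / 2) ×ˢ simplexStar a b (n / 2))
      (fun q => upperEven γ b q.1 q.2) (fun q => upperEvenLaw b q.1 q.2) := by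
  have hn2 := Nat.even_iff.1 hn
  have hE : IsExtremalShape n a b 0 (n / 2) {b} :=
    ⟨by rw [Finset.card_singleton]; omega, 2, by norm_num, by rw [Nat.even_iff]; omega, by omega,
      by norm_num, by simp⟩
  refine hE.isExtremalParametrization hab hγ ?_ ?_
  · rintro ⟨β, y⟩ ⟨⟨hβ, hβ1⟩, hy, -⟩
    refine ⟨Option (Fin (n / 2)), inferInstance, fun o => o.elim (1 - ∑ j, β j) β,
      fun o => o.elim b y, ?_, by simp, ?_, ⟨y, ?_⟩, ?_, ?_⟩
    · rintro (_ | j)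
      exacts [sub_nonneg.2 hβ1, hβ j]
    · rintro (_ | j)
      exacts [⟨hab.le, le_rfl⟩, hy j]
    · rintro (_ | j)
      exacts [Or.inl (by simp), Or.inr ⟨j, rfl⟩]
    · simp [upperEven, add_comm]
    · simp [upperEvenLaw, add_comm]
  · intro w y hw hy hsum
    rw [Finset.sum_singleton] at hsum
    refine ⟨⟨fun j => w (y j), y⟩, ⟨⟨fun j => hw _, ?_⟩, hy⟩, ?_⟩
    · linarith [hw b]
    · simp only [upperEven, Finset.sum_singleton]
      rw [← hsum, add_sub_cancel_right]
      abel

/-- With offset 1 the nodes begin in the gap after a and end at an atom, so a must be exempt. -/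
lemma isExtremalParametrization_lowerEven {n : ℕ} {γ : ℝ → Fin (n + 1) → ℝ} {a b : ℝ}
    (hab : a < b) (hγ : HasTotallyPositiveTorsion γ a b) (hn : Even n) :
    IsExtremalParametrization.{u} γ a b 1 (simplexC (n / 2) ×ˢ simplexStar a b (n / 2))
      (fun q => lowerEven γ a q.1 q.2) (fun q => lowerEvenLaw a q.1 q.2) := by
  have hn2 := Nat.even_iff.1 hn
  have hE : IsExtremalShape n a b 1 (n / 2) {a} :=
    ⟨by rw [Finset.card_singleton]; omega, 1, by norm_num, by rw [Nat.even_iff]; omega, by omega,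
      by simp, by omega⟩
  refine hE.isExtremalParametrization hab hγ ?_ ?_
  · rintro ⟨β, y⟩ ⟨⟨hβ, hβ1⟩, hy, -⟩
    refine ⟨Option (Fin (n / 2)), inferInstance, fun o => o.elim (1 - ∑ j, β j) β,
      fun o => o.elim a y, ?_, by simp, ?_, ⟨y, ?_⟩, ?_, ?_⟩
    · rintro (_ | j)
      exacts [sub_nonneg.2 hβ1, hβ j]
    · rintro (_ | j)
      exacts [⟨le_rfl, hab.le⟩, hy j]
    · rintro (_ | j)
      exacts [Or.inl (by simp), Or.inr ⟨j, rfl⟩]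
    · simp [lowerEven]
    · simp [lowerEvenLaw]
  · intro w y hw hy hsum
    rw [Finset.sum_singleton] at hsum
    refine ⟨⟨fun j => w (y j), y⟩, ⟨⟨fun j => hw _, ?_⟩, hy⟩, ?_⟩
    · linarith [hw a]
    · simp only [lowerEven, Finset.sum_singleton]
      rw [← hsum, add_sub_cancel_right]

/-- The nodes begin and end with positive masses, in the gaps after a and before b; both endpoints
are exempt. -/
lemma isExtremalParametrization_upperOdd {n : ℕ} {γ : ℝ → Fin (n + 1) → ℝ} {a b : ℝ}
    (hab : a < b) (hγ : HasTotallyPositiveTorsion γ a b) (hn : Odd n) :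
    IsExtremalParametrization.{u} γ a b 0 (simplexC (n / 2 + 1) ×ˢ simplexStar a b (n / 2))
      (fun q => upperOdd γ a b q.1 q.2) (fun q => upperOddLaw a b q.1 q.2) := by
  have hn2 := Nat.odd_iff.1 hn
  have hE : IsExtremalShape n a b 0 (n / 2) {a, b} :=
    ⟨by rw [Finset.card_pair hab.ne]; omega, 1, by norm_num, by rw [Nat.even_iff]; omega,
      by omega, by simp, by simp⟩
  refine hE.isExtremalParametrization hab hγ ?_ ?_
  · rintro ⟨β, y⟩ ⟨⟨hβ, hβ1⟩, hy, -⟩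
    -- `none` indexes the node a, `some none` the node b.
    refine ⟨Option (Option (Fin (n / 2))), inferInstance,
      fun o => o.elim (1 - ∑ j, β j) fun o => o.elim (β 0) fun j => β j.succ,
      fun o => o.elim a fun o => o.elim b y, ?_, ?_, ?_, ⟨y, ?_⟩, ?_, ?_⟩
    · rintro (_ | _ | j)
      exacts [sub_nonneg.2 hβ1, hβ 0, hβ j.succ]
    · simp [Fin.sum_univ_succ]
    · rintro (_ | _ | j)
      exacts [⟨le_rfl, hab.le⟩, ⟨hab.le, le_rfl⟩, hy j]
    · rintro (_ | _ | j)
      exacts [Or.inl (by simp), Or.inl (by simp), Or.inr ⟨j, rfl⟩]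
    · simp only [upperOdd, Fintype.sum_option, Option.elim]
      abel
    · simp only [upperOddLaw, Fintype.sum_option, Option.elim]
      abel
  · intro w y hw hy hsum
    rw [Finset.sum_pair hab.ne] at hsum
    have hcons : ∑ j, (Fin.cons (w b) fun j => w (y j) : Fin (n / 2 + 1) → ℝ) j =
        w b + ∑ j, w (y j) := by simp [Fin.sum_univ_succ]
    refine ⟨⟨Fin.cons (w b) fun j => w (y j), y⟩, ⟨⟨?_, ?_⟩, hy⟩, ?_⟩
    · intro j
      refine Fin.cases ?_ (fun j => ?_) j
      · simpa using hw b
      · simpa using hw (y j)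
    · rw [hcons]
      linarith [hw a]
    · simp only [upperOdd, hcons, Fin.cons_zero, Fin.cons_succ]
      have hwa : 1 - (w b + ∑ j, w (y j)) = w a := by linarith
      rw [Finset.sum_pair hab.ne, hwa]
      abel

/-- The nodes begin and end at atoms, so no gap at an endpoint is needed and E is empty. -/
lemma isExtremalParametrization_lowerOdd {n : ℕ} {γ : ℝ → Fin (n + 1) → ℝ} {a b : ℝ}
    (hab : a < b) (hγ : HasTotallyPositiveTorsion γ a b) (hn : Odd n) :
    IsExtremalParametrization.{u} γ a b 1 (simplexC (n / 2) ×ˢ simplexStar a b (n / 2 + 1))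
      (fun q => lowerOdd γ q.1 q.2) (fun q => lowerOddLaw q.1 q.2) := by
  have hn2 := Nat.odd_iff.1 hn
  have hE : IsExtremalShape n a b 1 (n / 2 + 1) ∅ :=
    ⟨by rw [Finset.card_empty]; omega, 2, by norm_num, by rw [Nat.even_iff]; omega, by omega,
      by norm_num, by omega⟩
  refine hE.isExtremalParametrization hab hγ ?_ ?_
  · rintro ⟨β, y⟩ ⟨⟨hβ, hβ1⟩, hy, -⟩
    refine ⟨Option (Fin (n / 2)), inferInstance, fun o => o.elim (1 - ∑ j, β j) β,
      fun o => o.elim (y 0) fun j => y j.succ, ?_, by simp, ?_, ⟨y, ?_⟩, ?_, ?_⟩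
    · rintro (_ | j)
      exacts [sub_nonneg.2 hβ1, hβ j]
    · rintro (_ | j)
      exacts [hy 0, hy j.succ]
    · rintro (_ | j)
      exacts [Or.inr ⟨0, rfl⟩, Or.inr ⟨j.succ, rfl⟩]
    · simp [lowerOdd]
    · simp [lowerOddLaw]
  · intro w y hw hy hsum
    rw [Finset.sum_empty, zero_add, Fin.sum_univ_succ] at hsum
    refine ⟨⟨fun j => w (y j.succ), y⟩, ⟨⟨fun j => hw _, ?_⟩, hy⟩, ?_⟩
    · linarith [hw (y 0)]
    · simp only [lowerOdd]
      rw [← hsum, add_sub_cancel_right, Finset.sum_empty, zero_add, Fin.sum_univ_succ]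

theorem theorem2p3 {n : ℕ} (hn : 1 ≤ n) {a b : ℝ} (hab : a < b)
    (γ : ℝ → Fin (n + 1) → ℝ) (hγ : HasTotallyPositiveTorsion γ a b) :
    -- the supremum and the infimum
    (∀ x ∈ convexHull ℝ ((fun t => bar (γ t)) '' Set.Icc a b),
      IsLUB (momentValues.{u} γ a b x) (Bsup γ a b x) ∧
      IsGLB (momentValues.{u} γ a b x) (Binf γ a b x)) ∧
    -- Case 1, `n` odd
    (Odd n →
      -- `B^sup` and `B^inf` are well defined by `B^sup(Ūₙ) = Uₙ^z` and `B^inf(L̄ₙ) = Lₙ^z`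
      (∀ β ∈ simplexC (n / 2 + 1), ∀ y ∈ simplexStar a b (n / 2),
        Bsup γ a b (bar (upperOdd γ a b β y)) = lastCoord (upperOdd γ a b β y)) ∧
      (∀ β ∈ simplexC (n / 2), ∀ y ∈ simplexStar a b (n / 2 + 1),
        Binf γ a b (bar (lowerOdd γ β y)) = lastCoord (lowerOdd γ β y)) ∧
      -- `x` has the stated representations, and each of them gives an extremizer
      ∀ x ∈ convexHull ℝ ((fun t => bar (γ t)) '' Set.Icc a b),
        (∃ β ∈ simplexC (n / 2 + 1), ∃ y ∈ simplexStar a b (n / 2),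
          x = bar (upperOdd γ a b β y)) ∧
        (∀ β ∈ simplexC (n / 2 + 1), ∀ y ∈ simplexStar a b (n / 2),
          x = bar (upperOdd γ a b β y) →
            AttainedByLaw.{u} γ a b x (upperOddLaw a b β y) (Bsup γ a b x)) ∧
        (∃ β ∈ simplexC (n / 2), ∃ y ∈ simplexStar a b (n / 2 + 1),
          x = bar (lowerOdd γ β y)) ∧
        (∀ β ∈ simplexC (n / 2), ∀ y ∈ simplexStar a b (n / 2 + 1),
          x = bar (lowerOdd γ β y) →
            AttainedByLaw.{u} γ a b x (lowerOddLaw β y) (Binf γ a b x))) ∧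
    -- Case 2, `n` even
    (Even n →
      (∀ β ∈ simplexC (n / 2), ∀ y ∈ simplexStar a b (n / 2),
        Bsup γ a b (bar (upperEven γ b β y)) = lastCoord (upperEven γ b β y)) ∧
      (∀ β ∈ simplexC (n / 2), ∀ y ∈ simplexStar a b (n / 2),
        Binf γ a b (bar (lowerEven γ a β y)) = lastCoord (lowerEven γ a β y)) ∧
      ∀ x ∈ convexHull ℝ ((fun t => bar (γ t)) '' Set.Icc a b),
        (∃ β ∈ simplexC (n / 2), ∃ y ∈ simplexStar a b (n / 2),
          x = bar (upperEven γ b β y)) ∧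
        (∀ β ∈ simplexC (n / 2), ∀ y ∈ simplexStar a b (n / 2),
          x = bar (upperEven γ b β y) →
            AttainedByLaw.{u} γ a b x (upperEvenLaw b β y) (Bsup γ a b x)) ∧
        (∃ β ∈ simplexC (n / 2), ∃ y ∈ simplexStar a b (n / 2),
          x = bar (lowerEven γ a β y)) ∧
        (∀ β ∈ simplexC (n / 2), ∀ y ∈ simplexStar a b (n / 2),
          x = bar (lowerEven γ a β y) →
            AttainedByLaw.{u} γ a b x (lowerEvenLaw a β y) (Binf γ a b x))) := by
  refine ⟨fun x hx => ?_, fun hodd => ?_, fun heven => ?_⟩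
  · rcases Nat.even_or_odd n with heven | hodd
    · rw [Bsup, Binf, if_pos heven, if_pos heven]
      exact ⟨(isExtremalParametrization_upperEven hab hγ heven).isLUB hγ hx,
        (isExtremalParametrization_lowerEven hab hγ heven).isGLB hγ hx⟩
    · rw [Bsup, Binf, if_neg (Nat.not_even_iff_odd.2 hodd), if_neg (Nat.not_even_iff_odd.2 hodd)]
      exact ⟨(isExtremalParametrization_upperOdd hab hγ hodd).isLUB hγ hx,
        (isExtremalParametrization_lowerOdd hab hγ hodd).isGLB hγ hx⟩
  · have hU := isExtremalParametrization_upperOdd.{u} hab hγ hodd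
    have hL := isExtremalParametrization_lowerOdd.{u} hab hγ hodd
    rw [Bsup, Binf, if_neg (Nat.not_even_iff_odd.2 hodd), if_neg (Nat.not_even_iff_odd.2 hodd)]
    refine ⟨fun β hβ y hy => hU.graphFunction_bar (q := (β, y)) ⟨hβ, hy⟩,
      fun β hβ y hy => hL.graphFunction_bar (q := (β, y)) ⟨hβ, hy⟩, fun x hx => ⟨?_, ?_, ?_, ?_⟩⟩
    · obtain ⟨q, hq, rfl⟩ := hU.surjective x hx
      exact ⟨q.1, hq.1, q.2, hq.2, rfl⟩
    · rintro β hβ y hy rfl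
      exact hU.attainedByLaw (q := (β, y)) ⟨hβ, hy⟩
    · obtain ⟨q, hq, rfl⟩ := hL.surjective x hx
      exact ⟨q.1, hq.1, q.2, hq.2, rfl⟩
    · rintro β hβ y hy rfl
      exact hL.attainedByLaw (q := (β, y)) ⟨hβ, hy⟩
  · have hU := isExtremalParametrization_upperEven.{u} hab hγ heven
    have hL := isExtremalParametrization_lowerEven.{u} hab hγ heven
    rw [Bsup, Binf, if_pos heven, if_pos heven]
    refine ⟨fun β hβ y hy => hU.graphFunction_bar (q := (β, y)) ⟨hβ, hy⟩,
      fun β hβ y hy => hL.graphFunction_bar (q := (β, y)) ⟨hβ, hy⟩, fun x hx => ⟨?_, ?_, ?_, ?_⟩⟩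
    · obtain ⟨q, hq, rfl⟩ := hU.surjective x hx
      exact ⟨q.1, hq.1, q.2, hq.2, rfl⟩
    · rintro β hβ y hy rfl
      exact hU.attainedByLaw (q := (β, y)) ⟨hβ, hy⟩
    · obtain ⟨q, hq, rfl⟩ := hL.surjective x hx
      exact ⟨q.1, hq.1, q.2, hq.2, rfl⟩
    · rintro β hβ y hy rfl
      exact hL.attainedByLaw (q := (β, y)) ⟨hβ, hy⟩
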